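/- All posets are finite and non-empty. Let $[n]=\{1,\dots,n\}$, let $\mathcal P(n)$ be the power set of $[n]$ ordered by inclusion, and let $\mathcal P(n,p)$ be the random subposet of $\mathcal P(n)$ obtained by retaining each element independently with probability $p$. A property of $\mathcal P(n,p)$ holds w.h.p. if its probability tends to $1$ as $n\to\infty$. A copy of a poset $P$ in a poset $R$ is an injective map $\phi:P\to R$ with $\phi(x)\le\phi(y)$ whenever $x\le y$ (not necessarily induced). A poset $R$ is $(P,Q)$-Ramsey, written $R\to(P,Q)$, if every colouring of the elements of $R$ with colours $1$ and $2$ contains a copy of $P$ with all elements in colour $1$ or a copy of $Q$ with all elements in colour $2$. The lower Ramsey exponent of $(P,Q)$ is $$c_{\mathrm{Ram}^-}(P,Q)=\sup\{c>0:\ \mathcal P(n,e^{-cn})\to(P,Q)\text{ holds w.h.p.}\}.$$ Let $\mathcal A(P)$ be the set of antichains of $P$ (including $\emptyset$), and let $\triangle_{\mathcal A(P)}$ be the set of vectors $\alpha=(\alpha_S)_{S\in\mathcal A(P)}$ of non-negative reals with sum $1$. For $\emptyset\ne X\subseteq P$ and $S\in\mathcal A(P)$, let $\partial_X S$ be the set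 of minimal elements of $\{y\in X:\ x\le y\text{ for some }x\in S\}$, an antichain of $X$. For $T\in\mathcal A(X)$ put $\partial_X(\alpha)_T=\sum_{S\in\mathcal A(P):\,\partial_X S=T}\alpha_S$. With $H(\beta)=-\sum_i\beta_i\log\beta_i$ (natural logarithm, $0\log 0=0$), the critical exponent of $P$ is $$c_\star(P)=\sup\Bigl\{c\ge 0:\ \exists\,\alpha\in\triangle_{\mathcal A(P)}\ \text{such that}\ c\le \frac{H(\partial_X(\alpha))}{|X|}\ \text{for all}\ \emptyset\neq X\subseteq P\Bigr\}.$$ The lexicographic product $P\times_{\mathrm{lex}}Q$ is the set $P\times Q$ ordered by: $(p,q)\le(p',q')$ if and only if $p<p'$, or $p=p'$ and $q\le q'$. **Theorem.** Let $P$ and $Q$ be finite non-empty posets. Then $P\times_{\mathrm{lex}}Q$ is $(P,Q)$-Ramsey, and $$c_\star(P\times_{\mathrm{lex}}Q)\le c_{\mathrm{Ram}^-}(P,Q).$$ -/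

import Mathlib

open Filter Topology ProbabilityTheory

namespace RandomPoset

/-- `R` is `(P, Q)`-Ramsey: every colouring of the elements of `R` with the colours `0` and `1`
contains a copy of `P` all of whose elements have colour `0`, or a copy of `Q` all of whose elements
have colour `1`. A copy of `P` in `R` is an injective order homomorphism from `P` to `R`
(not necessarily an induced one). -/
def IsRamsey (R P Q : Type*) [PartialOrder R] [PartialOrder P] [PartialOrder Q] : Prop :=
  ∀ χ : R → Fin 2,
    (∃ φ : P → R, Monotone φ ∧ Function.Injective φ ∧ ∀ x, χ (φ x) = 0) ∨
    (∃ ψ : Q → R, Monotone ψ ∧ Function.Injective ψ ∧ ∀ y, χ (ψ y) = 1)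

/-- The retention probability `e^{-cn}`, for `c > 0`. -/
noncomputable def retentionProb (c : ℝ) (hc : 0 < c) (n : ℕ) : unitInterval :=
  ⟨Real.exp (-c * n), (Real.exp_pos _).le,
    Real.exp_le_one_iff.2 (mul_nonpos_of_nonpos_of_nonneg (by linarith) n.cast_nonneg)⟩

/-- The random poset `𝒫(n, e^{-cn})`, the random subset of the Boolean lattice of dimension `n` in
which each element is retained independently with probability `e^{-cn}` (ordered by inclusion),
is with high probability `(P, Q)`-Ramsey. -/
def RamseyWHP (P Q : Type*) [PartialOrder P] [PartialOrder Q] (c : ℝ) (hc : 0 < c) : Prop :=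
  Tendsto
    (fun n : ℕ => (setBernoulli (Set.univ : Set (Finset (Fin n))) (retentionProb c hc n)).real
      {S : Set (Finset (Fin n)) | IsRamsey ↥S P Q})
    atTop (𝓝 1)

/-- The lower Ramsey exponent of `(P, Q)`. -/
noncomputable def lowerRamseyExponent (P Q : Type*) [PartialOrder P] [PartialOrder Q] : ℝ :=
  sSup {c : ℝ | ∃ hc : 0 < c, RamseyWHP P Q c hc}

/-- The antichains of `P`, the empty one included. -/
def Antichain (P : Type*) [PartialOrder P] : Type _ :=
  {S : Set P // IsAntichain (· ≤ ·) S}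

noncomputable instance (P : Type*) [PartialOrder P] [Finite P] : Fintype (Antichain P) :=
  @Fintype.ofFinite _ (inferInstanceAs (Finite {S : Set P // IsAntichain (· ≤ ·) S}))

/-- The (upper) shadow in `Q ⊆ P` of an antichain `S` of `P`: the minimal elements among those
elements of `Q` that lie above some element of `S`. It is an antichain of the subposet `Q`. -/
def shadow {P : Type*} [PartialOrder P] (Q : Set P) (S : Antichain P) : Antichain ↥Q :=
  ⟨{y : ↥Q | (∃ x ∈ S.1, x ≤ (y : P)) ∧ ∀ z : ↥Q, z < y → ∀ x ∈ S.1, ¬ x ≤ (z : P)}, by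
    rintro y ⟨⟨x, hx, hxy⟩, -⟩ z ⟨-, hz⟩ hne hle
    exact hz y (lt_of_le_of_ne hle hne) x hx hxy⟩

/-- The weighting of the antichains of `Q` induced by a weighting `α` of the antichains of `P`. -/
noncomputable def inducedWeighting {P : Type*} [PartialOrder P] [Finite P] (Q : Set P)
    (α : Antichain P → ℝ) : Antichain ↥Q → ℝ :=
  open Classical in fun T => ∑ S : Antichain P with shadow Q S = T, α S

/-- The entropy `∑ -β log β` (natural logarithm, `0 log 0 = 0`). -/
noncomputable def entropy {ι : Type*} [Fintype ι] (β : ι → ℝ) : ℝ :=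
  ∑ i, Real.negMulLog (β i)

/-- The critical exponent of the subposet `Q` in `P` with respect to the weighting `α`. -/
noncomputable def subposetExponent {P : Type*} [PartialOrder P] [Finite P] (α : Antichain P → ℝ)
    (Q : Set P) : ℝ :=
  entropy (inducedWeighting Q α) / Q.ncard

/-- The critical exponent `c_⋆(P)` of a poset `P`. Weightings range over the probability vectors
indexed by the antichains of `P`. -/
noncomputable def criticalExponent (P : Type*) [PartialOrder P] [Finite P] : ℝ :=
  sSup {c : ℝ | 0 ≤ c ∧ ∃ α ∈ stdSimplex ℝ (Antichain P),
    ∀ Q : Set P, Q.Nonempty → c ≤ subposetExponent α Q}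

/-- The supremum defining `c_⋆(P)` is over a nonempty set. -/
theorem criticalExponent_nonempty (P : Type*) [PartialOrder P] [Finite P] :
    {c : ℝ | 0 ≤ c ∧ ∃ α ∈ stdSimplex ℝ (Antichain P),
    ∀ Q : Set P, Q.Nonempty → c ≤ subposetExponent α Q}.Nonempty := by
  classical
  let e : Antichain P := ⟨∅, by simp⟩
  refine ⟨0, le_rfl, Pi.single e 1, single_mem_stdSimplex ℝ e, fun Q _ => ?_⟩
  refine div_nonneg (Finset.sum_nonneg fun T _ => ?_) (by positivity)
  have hα := single_mem_stdSimplex ℝ e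
  refine Real.negMulLog_nonneg (Finset.sum_nonneg fun S _ => hα.1 S) ?_
  exact (Finset.sum_le_sum_of_subset_of_nonneg (Finset.filter_subset _ _) (fun S _ _ => hα.1 S)).trans hα.2.le

/-- The supremum defining `c_⋆(P)` is over a bounded set. -/
theorem criticalExponent_bddAbove (P : Type*) [PartialOrder P] [Finite P] [Nonempty P] :
    BddAbove {c : ℝ | 0 ≤ c ∧ ∃ α ∈ stdSimplex ℝ (Antichain P),
    ∀ Q : Set P, Q.Nonempty → c ≤ subposetExponent α Q} := by
  refine ⟨(∑ i : Antichain ↥(Set.univ : Set P), (1:ℝ)) / (Set.univ : Set P).ncard, ?_⟩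
  rintro c ⟨-, α, hα, h⟩
  refine (h Set.univ Set.univ_nonempty).trans ?_
  unfold subposetExponent entropy
  gcongr with i
  have h0 : 0 ≤ inducedWeighting Set.univ α i := Finset.sum_nonneg fun S _ => hα.1 S
  rcases h0.eq_or_lt with h0 | h0
  · rw [← h0]; simp
  · have h1 := Real.one_sub_inv_le_log_of_pos h0
    rw [Real.negMulLog]
    have h2 := mul_le_mul_of_nonneg_left h1 h0.le
    rw [mul_sub, mul_inv_cancel₀ h0.ne'] at h2
    linarith

/-- The supremum defining the lower Ramsey exponent is over a bounded set. -/
theorem lowerRamseyExponent_bddAbove (P Q : Type*) [PartialOrder P] [PartialOrder Q] [Nonempty P] [Nonempty Q] :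
   BddAbove {c : ℝ | ∃ hc : 0 < c, RamseyWHP P Q c hc} := by
  refine ⟨Real.log 2, ?_⟩
  rintro c ⟨hc, h⟩
  by_contra! hlt
  have key : ∀ n : ℕ, (setBernoulli (Set.univ : Set (Finset (Fin n))) (retentionProb c hc n)).real
      {S : Set (Finset (Fin n)) | IsRamsey ↥S P Q} ≤ 1 - (1 - Real.exp (-c*n))^(2^n) := by
    intro n
    have hs : {S : Set (Finset (Fin n)) | IsRamsey ↥S P Q} ⊆ {∅}ᶜ := by
      rintro S hS rfl
      rcases hS (fun _ => 0) with ⟨φ, -⟩ | ⟨φ, -⟩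
      · exact (φ (Classical.arbitrary P)).2
      · exact (φ (Classical.arbitrary Q)).2
    refine (MeasureTheory.measureReal_mono hs).trans ?_
    rw [MeasureTheory.probReal_compl_eq_one_sub (by measurability), setBernoulli_real_singleton _ (by simp) (Set.toFinite _)]
    simp [retentionProb, Set.ncard_univ]
  have k2 : ∀ n : ℕ, 1 - (1 - Real.exp (-c*n))^(2^n) ≤ (2 * Real.exp (-c))^n := by
    intro n
    have h1 : Real.exp (-c*n) ≤ 1 := Real.exp_le_one_iff.2 (mul_nonpos_of_nonpos_of_nonneg (by linarith) n.cast_nonneg)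
    have := one_add_mul_le_pow (a := -Real.exp (-c*n)) (by linarith) (2^n)
    rw [mul_pow, ← Real.exp_nat_mul, mul_comm (n:ℝ)]
    push_cast at this
    rw [← sub_eq_add_neg] at this
    linarith
  have h3 : 2 * Real.exp (-c) < 1 := by
    rw [Real.exp_neg, ← div_eq_mul_inv, div_lt_one (Real.exp_pos _)]
    exact (Real.log_lt_iff_lt_exp two_pos).1 hlt
  have h4 := tendsto_pow_atTop_nhds_zero_of_lt_one (by positivity) h3
  have := le_of_tendsto_of_tendsto' h h4 (fun n => (key n).trans (k2 n))
  linarith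

end RandomPoset

namespace RandomPoset

/-! ### Second moment method for random subsets -/

open MeasureTheory

/-! The bound holds with any `(P, Q)`-Ramsey poset `R` in place of the lexicographic product: the
Ramsey property passes along copies, so it suffices that for `0 < c < c_⋆(R)` the random poset
contains a copy of `R` w.h.p. (`tendsto_containsCopy`).

For this, draw `n` antichains independently with law `α`; `copyMap` turns them into an order
homomorphism from `R` to the Boolean lattice. Its restriction to `X` determines the shadows in `X`,
and a typical shadow sequence has probability about `exp (-n H(∂_X α))`, which is below `exp (-d n
|X|)` for some `d > c`. Hence two independent typical maps agree on `X`, up to relabelling, with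
probability at most a constant times that, which beats the factor `exp (c n |X|)` that sharing `|X|`
elements costs in the second moment. The weighted count of copies therefore concentrates.

The product is Ramsey because either some fibre `{p} × Q` is entirely of colour `1`, or each fibre
contains a point of colour `0`, and one such point per fibre gives a copy of `P`. -/

lemma setBernoulli_univ_real_superset {V : Type*} [Finite V] (p : unitInterval) (A : Finset V) :
    (setBernoulli (Set.univ : Set V) p).real {S | (A : Set V) ⊆ S} = (p : ℝ) ^ A.card := by
  classical
  have := Fintype.ofFinite V
  have h : (fun q : V → Prop => {i | q i}) ⁻¹' {S | (A : Set V) ⊆ S}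
      = Set.pi (A : Set V) (fun _ => {True}) := by
    ext q
    simp [Set.subset_def, Set.pi]
  rw [measureReal_def, setBernoulli_apply', h, Measure.infinitePi_pi _ (fun _ _ => by measurability)]
  simp

/-- The second moment bound for a weighted family of `r`-sets in a random set. -/
lemma setBernoulli_univ_real_forall_not_subset_le {V ι : Type*} [Finite V] [DecidableEq V]
    (s : Finset ι) (p : unitInterval) (hp : 0 < (p : ℝ)) (A : ι → Finset V) (r : ℕ)
    (hA : ∀ i ∈ s, (A i).card = r) (w : ι → ℝ) (hw : 0 < ∑ i ∈ s, w i) :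
    (setBernoulli (Set.univ : Set V) p).real {S | ∀ i ∈ s, ¬ (A i : Set V) ⊆ S} ≤
      (∑ i ∈ s, ∑ j ∈ s, w i * w j * ((p : ℝ) ^ (A i ∩ A j).card)⁻¹) / (∑ i ∈ s, w i) ^ 2 - 1 := by
  classical
  set μ := setBernoulli (Set.univ : Set V) p
  set W := ∑ i ∈ s, w i
  have hsup : ∀ B : Finset V, ∫ S, {S : Set V | (B : Set V) ⊆ S}.indicator (1 : Set V → ℝ) S ∂μ
      = (p : ℝ) ^ B.card := fun B => by
    rw [integral_indicator_one (Set.toFinite _).measurableSet, setBernoulli_univ_real_superset]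
  set Z : Set V → ℝ := fun S => ∑ i ∈ s, w i * {S : Set V | (A i : Set V) ⊆ S}.indicator 1 S
  have hZ : ∫ S, Z S ∂μ = W * (p : ℝ) ^ r := by
    rw [integral_finsetSum _ fun _ _ => .of_finite, Finset.sum_mul]
    refine Finset.sum_congr rfl fun i hi => ?_
    rw [integral_const_mul, hsup, hA i hi]
  have hZ2 : ∫ S, Z S ^ 2 ∂μ
      = (p : ℝ) ^ (2 * r) * ∑ i ∈ s, ∑ j ∈ s, w i * w j * ((p : ℝ) ^ (A i ∩ A j).card)⁻¹ := by
    have h : ∀ S, Z S ^ 2 = ∑ i ∈ s, ∑ j ∈ s,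
        w i * w j * {S : Set V | ((A i ∪ A j : Finset V) : Set V) ⊆ S}.indicator 1 S := by
      intro S
      rw [sq, Finset.sum_mul_sum]
      refine Finset.sum_congr rfl fun i _ => Finset.sum_congr rfl fun j _ => ?_
      simp only [Set.indicator_apply, Set.mem_ofPred_eq, Finset.coe_union, Set.union_subset_iff,
        Pi.one_apply]
      split_ifs <;> grind
    simp_rw [h]
    rw [integral_finsetSum _ fun _ _ => .of_finite, Finset.mul_sum]
    refine Finset.sum_congr rfl fun i hi => ?_
    rw [integral_finsetSum _ fun _ _ => .of_finite, Finset.mul_sum]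
    refine Finset.sum_congr rfl fun j hj => ?_
    rw [integral_const_mul, hsup]
    have hc := Finset.card_union_add_card_inter (A i) (A j)
    rw [hA i hi, hA j hj, ← two_mul] at hc
    rw [← hc, pow_add]
    field_simp
  have hm : 0 < W * (p : ℝ) ^ r := by positivity
  calc μ.real {S | ∀ i ∈ s, ¬ (A i : Set V) ⊆ S}
      = ∫ S, {S | ∀ i ∈ s, ¬ (A i : Set V) ⊆ S}.indicator (1 : Set V → ℝ) S ∂μ := by
        rw [integral_indicator_one (Set.toFinite _).measurableSet]
    -- Chebyshev: the indicator of `Z = 0` is at most `(1 - Z / E Z) ^ 2`, expanded here.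
    _ ≤ ∫ S, (1 - 2 / (W * (p : ℝ) ^ r) * Z S + 1 / (W * (p : ℝ) ^ r) ^ 2 * Z S ^ 2) ∂μ := by
        refine integral_mono .of_finite .of_finite fun S => ?_
        by_cases hS : ∀ i ∈ s, ¬ (A i : Set V) ⊆ S
        · have : Z S = 0 := Finset.sum_eq_zero fun i hi => by simp [hS i hi]
          have hmem : S ∈ {S : Set V | ∀ i ∈ s, ¬ (A i : Set V) ⊆ S} := hS
          rw [Set.indicator_of_mem hmem]
          simp [this]
        · rw [Set.indicator_of_notMem (by simpa using hS)]
          have : 0 ≤ (1 - Z S / (W * (p : ℝ) ^ r)) ^ 2 := sq_nonneg _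
          exact this.trans_eq (by ring)
    _ = _ := by
        rw [integral_add .of_finite .of_finite, integral_sub .of_finite .of_finite,
          integral_const_mul, integral_const_mul, hZ, hZ2]
        simp only [integral_const, probReal_univ, smul_eq_mul]
        field_simp
        ring

/-! ### Large deviations for independent letters -/

section Sequences

variable {ι : Type*} [Fintype ι]

/-- Multiplicative Markov inequality for sequences of independent letters. -/
lemma sum_prod_le_pow {n : ℕ} {α h : ι → ℝ} (hα : ∀ a, 0 ≤ α a) (hh : ∀ a, 0 ≤ h a)
    (s : Finset (Fin n → ι)) (hs : ∀ f ∈ s, 1 ≤ ∏ i, h (f i)) :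
    ∑ f ∈ s, ∏ i, α (f i) ≤ (∑ a, α a * h a) ^ n := by
  rw [Fintype.sum_pow]
  refine (Finset.sum_le_sum fun f hf => ?_).trans (Finset.sum_le_sum_of_subset_of_nonneg
    (Finset.subset_univ s) fun f _ _ => Finset.prod_nonneg fun i _ => mul_nonneg (hα _) (hh _))
  rw [Finset.prod_mul_distrib]
  exact le_mul_of_one_le_right (Finset.prod_nonneg fun i _ => hα _) (hs f hf)

lemma sum_prod_fiber {κ : Type*} [DecidableEq κ] {n : ℕ} (α : ι → ℝ) (g : ι → κ)
    (t : Fin n → κ) :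
    ∑ f : Fin n → ι with ∀ i, g (f i) = t i, ∏ i, α (f i) = ∏ i, ∑ a with g a = t i, α a := by
  classical
  rw [Finset.prod_univ_sum]
  congr 1
  ext f
  simp [Fintype.mem_piFinset]

/-- Chernoff's argument: the moment generating function equals `1` at `0`, where its derivative is
the negative mean. -/
lemma exists_sum_mul_exp_lt_one {α L : ι → ℝ} (hα : ∑ a, α a = 1) (hL : ∑ a, α a * L a < 0) :
    ∃ s : ℝ, 0 < s ∧ ∑ a, α a * Real.exp (s * L a) < 1 := by
  have hd : HasDerivAt (fun s : ℝ => ∑ a, α a * Real.exp (s * L a)) (∑ a, α a * L a) 0 := by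
    refine HasDerivAt.fun_sum fun a _ => ?_
    have := (((hasDerivAt_id (0 : ℝ)).mul_const (L a)).exp).const_mul (α a)
    simpa using this
  have h0 : ∑ a, α a * Real.exp (0 * L a) = 1 := by simpa using hα
  have hs := ((hasDerivWithinAt_iff_tendsto_slope' Set.self_notMem_Ioi).1
    (hd.hasDerivWithinAt (s := Set.Ioi 0))).eventually (eventually_lt_nhds hL)
  obtain ⟨s, hs, hpos⟩ := (hs.and self_mem_nhdsWithin).exists
  refine ⟨s, hpos, ?_⟩
  rw [slope_def_field, h0, sub_zero] at hs
  have h1 := (div_lt_iff₀ hpos).1 hs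
  linarith

/-- The event `B` has vanishing probability for sequences of independent letters of law `α`. -/
def Negligible (α : ι → ℝ) (B : ∀ n, (Fin n → ι) → Prop) : Prop :=
  open Classical in
  Tendsto (fun n => ∑ f : Fin n → ι with B n f, ∏ i, α (f i)) atTop (𝓝 0)

lemma negligible_of_one_le_prod {α h : ι → ℝ} (hα : ∀ a, 0 ≤ α a) (hh : ∀ a, 0 ≤ h a)
    (hlt : ∑ a, α a * h a < 1) {B : ∀ n, (Fin n → ι) → Prop}
    (hB : ∀ n f, B n f → 1 ≤ ∏ i, h (f i)) : Negligible α B := by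
  classical
  refine squeeze_zero (fun n => Finset.sum_nonneg fun f _ => Finset.prod_nonneg fun i _ => hα _)
    (fun n => ?_) (tendsto_pow_atTop_nhds_zero_of_lt_one
      (Finset.sum_nonneg fun a _ => mul_nonneg (hα a) (hh a)) hlt)
  exact sum_prod_le_pow hα hh _ fun f hf => hB n f (by simpa using hf)

lemma Negligible.exists {κ : Type*} [Finite κ] {α : ι → ℝ} (hα : ∀ a, 0 ≤ α a)
    {B : κ → ∀ n, (Fin n → ι) → Prop} (hB : ∀ k, Negligible α (B k)) :
    Negligible α fun n f => ∃ k, B k n f := by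
  classical
  have := Fintype.ofFinite κ
  have h := tendsto_finsetSum (Finset.univ : Finset κ) fun k _ => hB k
  rw [Finset.sum_const_zero] at h
  have hw : ∀ n (f : Fin n → ι), 0 ≤ ∏ i, α (f i) := fun n f => Finset.prod_nonneg fun i _ => hα _
  refine squeeze_zero (fun n => Finset.sum_nonneg fun f _ => hw n f) (fun n => ?_) h
  simp_rw [Finset.sum_filter]
  rw [Finset.sum_comm]
  refine Finset.sum_le_sum fun f _ => ?_
  have hite : ∀ k ∈ Finset.univ, 0 ≤ if B k n f then ∏ i, α (f i) else 0 := fun k _ => by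
    split_ifs <;> simp [hw n f]
  split_ifs with hk
  · obtain ⟨k, hk⟩ := hk
    refine le_trans ?_ (Finset.single_le_sum hite (Finset.mem_univ k))
    rw [if_pos hk]
  · exact Finset.sum_nonneg hite

end Sequences

/-! ### Typical sequences of antichains -/

section Copies

variable {R : Type*} [PartialOrder R]

/-- The order homomorphism into the Boolean lattice given by a sequence of antichains: `x` is sent
to the set of coordinates whose antichain has an element below `x`. -/
noncomputable def copyMap {n : ℕ} (f : Fin n → Antichain R) (x : R) : Finset (Fin n) :=
  open Classical in Finset.univ.filter fun i => ∃ s ∈ (f i).1, s ≤ x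

lemma mem_copyMap {n : ℕ} {f : Fin n → Antichain R} {x : R} {i : Fin n} :
    i ∈ copyMap f x ↔ ∃ s ∈ (f i).1, s ≤ x := by
  simp [copyMap]

lemma copyMap_mono {n : ℕ} (f : Fin n → Antichain R) : Monotone (copyMap f) := by
  intro x y hxy i
  rw [mem_copyMap, mem_copyMap]
  rintro ⟨s, hs, h⟩
  exact ⟨s, hs, h.trans hxy⟩

lemma shadow_eq_of_forall {X : Set R} {S T : Antichain R}
    (h : ∀ y ∈ X, (∃ s ∈ S.1, s ≤ y) ↔ ∃ s ∈ T.1, s ≤ y) : shadow X S = shadow X T := by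
  have h' : ∀ y ∈ X, (∀ s ∈ S.1, ¬ s ≤ y) ↔ ∀ s ∈ T.1, ¬ s ≤ y := fun y hy => by
    simpa using not_congr (h y hy)
  refine Subtype.ext (Set.ext fun y => ?_)
  exact and_congr (h y y.2) (forall₂_congr fun z _ => h' z z.2)

lemma shadow_eq_of_copyMap_eq {n : ℕ} {X : Set R} {f g : Fin n → Antichain R}
    (h : ∀ y ∈ X, copyMap f y = copyMap g y) (i : Fin n) : shadow X (f i) = shadow X (g i) := by
  refine shadow_eq_of_forall fun y hy => ?_
  rw [← mem_copyMap, ← mem_copyMap, h y hy]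

variable [Finite R]

/-- The sequences of antichains which give an injective copy and all of whose restrictions to
nonempty subposets are as unlikely as the exponent `c` demands. -/
def IsTypical (α : Antichain R → ℝ) (c : ℝ) (n : ℕ) (f : Fin n → Antichain R) : Prop :=
  Function.Injective (copyMap f) ∧ ∀ X : Set R, X.Nonempty →
    ∏ i, inducedWeighting X α (shadow X (f i)) ≤ Real.exp (-c * n * X.ncard)

lemma inducedWeighting_shadow_pos {α : Antichain R → ℝ} (hα : ∀ S, 0 < α S) (X : Set R)
    (S : Antichain R) : 0 < inducedWeighting X α (shadow X S) :=
  Finset.sum_pos (fun S _ => hα S) ⟨S, by simp⟩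

/-- Writes the entropy as a mean over a random letter, so that large deviations apply to the
log-likelihood of the shadow sequence. -/
lemma entropy_inducedWeighting (α : Antichain R → ℝ) (X : Set R) :
    entropy (inducedWeighting X α)
      = -∑ S, α S * Real.log (inducedWeighting X α (shadow X S)) := by
  classical
  rw [← Finset.sum_fiberwise Finset.univ (shadow X), entropy, ← Finset.sum_neg_distrib]
  refine Finset.sum_congr rfl fun T _ => ?_
  rw [Real.negMulLog, neg_mul, neg_inj]
  conv_lhs => rw [inducedWeighting, Finset.sum_mul]
  refine Finset.sum_congr (by congr) fun S hS => ?_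
  rw [(Finset.mem_filter.1 hS).2]
  rfl

lemma negligible_not_isTypical {α : Antichain R → ℝ} (hα : ∀ S, 0 < α S) (hα1 : ∑ S, α S = 1)
    {c : ℝ} (hc : ∀ X : Set R, X.Nonempty → c < subposetExponent α X) :
    Negligible α fun n f => ¬ IsTypical α c n f := by
  classical
  have h1 : ∀ k : R × R ⊕ Set R, Negligible α fun n f => match k with
      | .inl k => ¬ k.1 ≤ k.2 ∧ copyMap f k.1 = copyMap f k.2
      | .inr X => X.Nonempty ∧
        Real.exp (-c * n * X.ncard) < ∏ i, inducedWeighting X α (shadow X (f i)) := by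
    rintro (⟨x, y⟩ | X)
    · by_cases hxy : x ≤ y
      · simp [Negligible, hxy]
      -- A coordinate with antichain `{x}` lies in the image of `x` but not in that of `y`, so equal
      -- images force this letter of positive weight never to occur.
      let S₀ : Antichain R := ⟨{x}, by simp⟩
      refine negligible_of_one_le_prod (h := fun S => if S = S₀ then 0 else 1) (fun S => (hα S).le)
        (fun S => by positivity) ?_ ?_
      · refine lt_of_lt_of_eq ?_ hα1
        refine Finset.sum_lt_sum (fun S _ => ?_) ⟨S₀, Finset.mem_univ _, by simpa using hα S₀⟩
        exact mul_le_of_le_one_right (hα S).le (by split_ifs <;> norm_num)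
      · rintro n f ⟨-, h⟩
        refine (Finset.prod_eq_one fun i _ => if_neg fun hi => hxy ?_).ge
        have hx : i ∈ copyMap f x := mem_copyMap.2 ⟨x, by simp [hi, S₀], le_rfl⟩
        rw [h, mem_copyMap, hi] at hx
        simpa [S₀] using hx
    · by_cases hX : X.Nonempty
      swap
      · simp [Negligible, hX]
      have hpos := inducedWeighting_shadow_pos hα X
      have hcard : (0 : ℝ) < X.ncard := by exact_mod_cast hX.ncard_pos
      have hE := (lt_div_iff₀ hcard).1 (hc X hX)
      rw [entropy_inducedWeighting] at hE
      -- The mean of `L` is `c |X| - H(∂_X α) < 0`, while the bad event says that `L` sums to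
      -- something positive.
      obtain ⟨s, hs, hlt⟩ := exists_sum_mul_exp_lt_one (α := α)
        (L := fun S => Real.log (inducedWeighting X α (shadow X S)) + c * X.ncard) hα1 (by
          simp_rw [mul_add, Finset.sum_add_distrib, ← Finset.sum_mul, hα1]
          linarith)
      refine negligible_of_one_le_prod (fun S => (hα S).le) (fun S => (Real.exp_pos _).le) hlt ?_
      rintro n f ⟨-, h⟩
      rw [← Real.exp_sum, Real.one_le_exp_iff, ← Finset.mul_sum, Finset.sum_add_distrib,
        ← Real.log_prod fun i _ => (hpos _).ne']
      have := (Real.lt_log_iff_exp_lt (Finset.prod_pos fun i _ => hpos _)).2 h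
      simp only [Finset.sum_const, Finset.card_univ, Fintype.card_fin, nsmul_eq_mul]
      refine mul_nonneg hs.le ?_
      linarith
  have h2 := Negligible.exists (fun S => (hα S).le) h1
  convert h2 using 3 with n f
  rw [IsTypical]
  constructor
  · intro h
    by_contra! hne
    refine h ⟨fun x y hxy => ?_, fun X hX => ?_⟩
    · have hx := hne (.inl (x, y))
      have hy := hne (.inl (y, x))
      simp only [not_and_or, not_not, hxy, not_true_eq_false, or_false] at hx hy
      exact le_antisymm hx hy
    · have := hne (.inr X)
      simpa [hX] using this
  · rintro ⟨⟨x, y⟩ | X, h, h'⟩ ⟨hinj, hX⟩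
    · exact h (hinj h').le
    · exact (hX X h).not_gt h'

/-- Few typical sequences agree with a prescribed map on a nonempty subposet. -/
lemma sum_typical_restrict_le {α : Antichain R → ℝ} (hα : ∀ S, 0 ≤ α S) {c : ℝ} {n : ℕ}
    {s : Finset (Fin n → Antichain R)} (hs : ∀ f ∈ s, IsTypical α c n f) {X : Set R}
    (hX : X.Nonempty) (ψ : R → Finset (Fin n)) :
    open Classical in
    ∑ g ∈ s with ∀ y ∈ X, copyMap g y = ψ y, ∏ i, α (g i) ≤ Real.exp (-c * n * X.ncard) := by
  classical
  -- All members of the class have the same shadows in `X` as `g₀`, so the typicality of `g₀` bounds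
  -- the whole class.
  rcases (s.filter fun g => ∀ y ∈ X, copyMap g y = ψ y).eq_empty_or_nonempty with h | ⟨g₀, hg₀⟩
  · rw [h, Finset.sum_empty]
    positivity
  rw [Finset.mem_filter] at hg₀
  refine le_trans ?_ ((hs g₀ hg₀.1).2 X hX)
  unfold inducedWeighting
  refine le_trans ?_ (sum_prod_fiber α (shadow X) fun i => shadow X (g₀ i)).le |>.trans_eq ?_
  · refine Finset.sum_le_sum_of_subset_of_nonneg (fun g hg => ?_) fun g _ _ =>
      Finset.prod_nonneg fun i _ => hα _
    rw [Finset.mem_filter] at hg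
    rw [Finset.mem_filter]
    exact ⟨Finset.mem_univ _, shadow_eq_of_copyMap_eq fun y hy => by rw [hg.2 y hy, hg₀.2 y hy]⟩
  · refine Finset.prod_congr rfl fun i _ => Finset.sum_congr (by congr) fun _ _ => rfl

end Copies

/-! ### Copies below the critical exponent -/

section Containment

variable {R : Type*} [PartialOrder R]

open Classical in
lemma continuous_subposetExponent [Finite R] (X : Set R) :
    Continuous fun α : Antichain R → ℝ => subposetExponent α X := by
  unfold subposetExponent entropy inducedWeighting
  refine Continuous.div_const (continuous_finsetSum _ fun T _ => ?_) _
  exact Real.continuous_negMulLog.comp (continuous_finsetSum _ fun S _ => continuous_apply S)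

/-- Below the critical exponent there are positive weightings with a margin. -/
lemma exists_pos_weighting [Finite R] {c : ℝ} (hc : c < criticalExponent R) :
    ∃ (d : ℝ) (α : Antichain R → ℝ), c < d ∧ (∀ S, 0 < α S) ∧ ∑ S, α S = 1 ∧
      ∀ X : Set R, X.Nonempty → d < subposetExponent α X := by
  obtain ⟨e, ⟨-, α, ⟨hα, hα1⟩, hX⟩, hce⟩ :=
    exists_lt_of_lt_csSup (criticalExponent_nonempty R) hc
  obtain ⟨d, hcd, hde⟩ := exists_between hce
  let N : ℝ := (Fintype.card (Antichain R) : ℕ)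
  have : Nonempty (Antichain R) := ⟨⟨∅, by simp⟩⟩
  have hN : 0 < N := Nat.cast_pos.2 Fintype.card_pos
  -- Mixing in a little of the uniform law makes all weights positive; continuity of the entropies
  -- preserves the strict margin.
  let γ : ℝ → Antichain R → ℝ := fun t S => (1 - t) * α S + t * N⁻¹
  have hγ : Continuous γ := by fun_prop
  have hγ0 : γ 0 = α := by ext S; simp [γ]
  have hev : ∀ᶠ t in 𝓝[>] (0 : ℝ), ∀ X : Set R, X.Nonempty → d < subposetExponent (γ t) X := by
    refine nhdsWithin_le_nhds (eventually_all.2 fun X => ?_)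
    by_cases hne : X.Nonempty
    · have := ((continuous_subposetExponent X).comp hγ).continuousAt (x := 0)
      have h0 : d < subposetExponent (γ 0) X := by
        rw [hγ0]
        exact hde.trans_le (hX X hne)
      filter_upwards [this.eventually (eventually_gt_nhds h0)] with t ht _ using ht
    · simp [hne]
  obtain ⟨t, ht, ht0, ht1⟩ := (hev.and (Ioo_mem_nhdsGT one_pos)).exists
  refine ⟨d, γ t, hcd, fun S => ?_, ?_, ht⟩
  · have := mul_nonneg (sub_nonneg.2 ht1.le) (hα S)
    have : 0 < t * N⁻¹ := by positivity
    simp only [γ]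
    linarith
  · simp only [γ, Finset.sum_add_distrib, ← Finset.mul_sum, hα1, Finset.sum_const,
      Finset.card_univ, nsmul_eq_mul]
    change (1 - t) * 1 + t * (N * N⁻¹) = 1
    field_simp
    ring

open Classical in
-- Union bound over the possible overlaps: `X` is the set of points whose image under `g` is also an
-- image under `f`, and `σ` matches them. The `1` covers disjoint images.
lemma inv_pow_card_inter_le [Fintype R] {n : ℕ} {p : ℝ} (hp : 0 < p) (hp1 : p ≤ 1)
    (f g : Fin n → Antichain R) :
    (p ^ (Finset.univ.image (copyMap f) ∩ Finset.univ.image (copyMap g)).card)⁻¹ ≤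
      1 + ∑ X : Set R with X.Nonempty, ∑ σ : R → R,
        if ∀ y ∈ X, copyMap g y = copyMap f (σ y) then (p ^ X.ncard)⁻¹ else 0 := by
  set I := Finset.univ.image (copyMap f) ∩ Finset.univ.image (copyMap g)
  have hnn : ∀ X : Set R, ∀ σ : R → R,
      0 ≤ if ∀ y ∈ X, copyMap g y = copyMap f (σ y) then (p ^ X.ncard)⁻¹ else 0 := fun X σ => by
    positivity
  let Y : Finset R := Finset.univ.filter fun y => ∃ x, copyMap f x = copyMap g y
  have hIY : I ⊆ Y.image (copyMap g) := by
    intro B hB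
    simp only [I, Finset.mem_inter, Finset.mem_image, Finset.mem_univ, true_and] at hB
    obtain ⟨⟨x, hx⟩, y, rfl⟩ := hB
    exact Finset.mem_image_of_mem _ (Finset.mem_filter.2 ⟨Finset.mem_univ _, x, hx⟩)
  have hcard : I.card ≤ Y.card := (Finset.card_le_card hIY).trans Finset.card_image_le
  have hle : (p ^ I.card)⁻¹ ≤ (p ^ Y.card)⁻¹ := by
    gcongr ?_⁻¹
    exact pow_le_pow_of_le_one hp.le hp1 hcard
  rcases Y.eq_empty_or_nonempty with hY | hY
  · rw [hY, Finset.card_empty, pow_zero, inv_one] at hle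
    have : 0 ≤ ∑ X : Set R with X.Nonempty, ∑ σ : R → R,
        if ∀ y ∈ X, copyMap g y = copyMap f (σ y) then (p ^ X.ncard)⁻¹ else 0 :=
      Finset.sum_nonneg fun X _ => Finset.sum_nonneg fun σ _ => hnn X σ
    linarith
  · have hσ : ∀ y, ∃ x, y ∈ Y → copyMap g y = copyMap f x := fun y => by
      by_cases hy : y ∈ Y
      · obtain ⟨x, hx⟩ := (Finset.mem_filter.1 hy).2
        exact ⟨x, fun _ => hx.symm⟩
      · exact ⟨y, fun h => absurd h hy⟩
    choose σ hσ using hσ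
    have h1 := Finset.single_le_sum (fun τ _ => hnn (Y : Set R) τ) (Finset.mem_univ σ)
    rw [if_pos fun y (hy : y ∈ (Y : Set R)) => hσ y hy, Set.ncard_coe_finset] at h1
    have h2 := Finset.single_le_sum
      (f := fun X : Set R => ∑ σ : R → R,
        if ∀ y ∈ X, copyMap g y = copyMap f (σ y) then (p ^ X.ncard)⁻¹ else 0)
      (fun X _ => Finset.sum_nonneg fun σ _ => hnn X σ)
      (Finset.mem_filter.2 ⟨Finset.mem_univ (Y : Set R), Finset.coe_nonempty.2 hY⟩ :
        (Y : Set R) ∈ Finset.univ.filter Set.Nonempty)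
    rw [Set.ncard_coe_finset] at h2
    linarith

open Classical in
-- Each overlap pattern `(X, σ)` contributes at most `exp (-(d - c) n |X|)` per `f`, and there are
-- boundedly many patterns as `n` grows.
lemma sum_sum_inv_pow_card_inter_le [Fintype R] {α : Antichain R → ℝ} (hα : ∀ S, 0 ≤ α S)
    {c d : ℝ} (hc : 0 ≤ c) (hcd : c ≤ d) {n : ℕ} {s : Finset (Fin n → Antichain R)}
    (hs : ∀ f ∈ s, IsTypical α d n f) :
    ∑ f ∈ s, ∑ g ∈ s, (∏ i, α (f i)) * (∏ i, α (g i)) * (Real.exp (-c * n) ^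
        (Finset.univ.image (copyMap f) ∩ Finset.univ.image (copyMap g)).card)⁻¹ ≤
      (∑ f ∈ s, ∏ i, α (f i)) ^ 2 + (∑ f ∈ s, ∏ i, α (f i)) *
        (Fintype.card (Set R) * Fintype.card (R → R) * Real.exp (-(d - c) * n)) := by
  set w : (Fin n → Antichain R) → ℝ := fun f => ∏ i, α (f i)
  have hw : ∀ f, 0 ≤ w f := fun f => Finset.prod_nonneg fun i _ => hα _
  set p := Real.exp (-c * n)
  have hp1 : p ≤ 1 := Real.exp_le_one_iff.2 (by
    have := mul_nonneg hc n.cast_nonneg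
    linarith)
  have key : ∀ f : Fin n → Antichain R, ∀ X : Set R, X.Nonempty → ∀ σ : R → R,
      ∑ g ∈ s, w g * (if ∀ y ∈ X, copyMap g y = copyMap f (σ y) then (p ^ X.ncard)⁻¹ else 0) ≤
        Real.exp (-(d - c) * n) := by
    intro f X hX σ
    simp_rw [mul_ite, mul_zero]
    rw [← Finset.sum_filter, ← Finset.sum_mul]
    have h := sum_typical_restrict_le hα hs hX fun y => copyMap f (σ y)
    have hX1 : (1 : ℝ) ≤ X.ncard := by exact_mod_cast hX.ncard_pos
    calc _ ≤ Real.exp (-d * n * X.ncard) * (p ^ X.ncard)⁻¹ := by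
          gcongr
          exact (Finset.sum_congr (by congr) fun _ _ => rfl).trans_le h
      _ = Real.exp (-((d - c) * n * X.ncard)) := by
        rw [← Real.exp_nat_mul, ← Real.exp_neg, ← Real.exp_add]
        congr 1
        ring
      _ ≤ _ := by
        gcongr
        rw [neg_mul, neg_le_neg_iff]
        exact le_mul_of_one_le_right (mul_nonneg (sub_nonneg.2 hcd) n.cast_nonneg) hX1
  calc _ ≤ ∑ f ∈ s, ∑ g ∈ s, w f * w g * (1 + ∑ X : Set R with X.Nonempty, ∑ σ : R → R,
        if ∀ y ∈ X, copyMap g y = copyMap f (σ y) then (p ^ X.ncard)⁻¹ else 0) := by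
        refine Finset.sum_le_sum fun f _ => Finset.sum_le_sum fun g _ => ?_
        exact mul_le_mul_of_nonneg_left (inv_pow_card_inter_le (Real.exp_pos _) hp1 f g)
          (mul_nonneg (hw f) (hw g))
    _ = (∑ f ∈ s, w f) ^ 2 + ∑ f ∈ s, w f * ∑ X : Set R with X.Nonempty, ∑ σ : R → R,
        ∑ g ∈ s, w g *
          if ∀ y ∈ X, copyMap g y = copyMap f (σ y) then (p ^ X.ncard)⁻¹ else 0 := by
        rw [sq, Finset.sum_mul_sum, ← Finset.sum_add_distrib]
        refine Finset.sum_congr rfl fun f _ => ?_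
        simp_rw [mul_add, Finset.sum_add_distrib, mul_one, mul_assoc]
        rw [← Finset.mul_sum, add_right_inj]
        rw [← Finset.mul_sum]
        congr 1
        simp_rw [Finset.mul_sum]
        rw [Finset.sum_comm]
        exact Finset.sum_congr rfl fun X _ => Finset.sum_comm
    _ ≤ _ := by
        rw [Finset.sum_mul]
        refine add_le_add_right (Finset.sum_le_sum fun f _ =>
          mul_le_mul_of_nonneg_left ?_ (hw f)) _
        calc _ ≤ ∑ X : Set R with X.Nonempty, ∑ σ : R → R, Real.exp (-(d - c) * n) :=
              Finset.sum_le_sum fun X hX => Finset.sum_le_sum fun σ _ =>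
                key f X (Finset.mem_filter.1 hX).2 σ
          _ ≤ ∑ X : Set R, ∑ σ : R → R, Real.exp (-(d - c) * n) :=
              Finset.sum_le_sum_of_subset_of_nonneg (Finset.filter_subset _ _) fun _ _ _ =>
                Finset.sum_nonneg fun _ _ => (Real.exp_pos _).le
          _ = _ := by
              simp [mul_assoc]

/-- Below the critical exponent of `R`, the random poset contains a copy of `R` with high
probability. -/
theorem tendsto_containsCopy [Finite R] {c : ℝ} (hc0 : 0 < c) (hc : c < criticalExponent R) :
    Tendsto (fun n : ℕ => (setBernoulli (Set.univ : Set (Finset (Fin n)))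
      (retentionProb c hc0 n)).real
        {S : Set (Finset (Fin n)) | ∃ φ : R → S, Monotone φ ∧ Function.Injective φ})
      atTop (𝓝 1) := by
  classical
  have := Fintype.ofFinite R
  obtain ⟨d, α, hcd, hα, hα1, hd⟩ := exists_pos_weighting hc
  let s : ∀ n, Finset (Fin n → Antichain R) := fun n => Finset.univ.filter (IsTypical α d n)
  have hs : ∀ n, ∀ f ∈ s n, IsTypical α d n f := fun n f hf => (Finset.mem_filter.1 hf).2
  let W : ℕ → ℝ := fun n => ∑ f ∈ s n, ∏ i, α (f i)
  have hW : Tendsto W atTop (𝓝 1) := by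
    have h := (negligible_not_isTypical hα hα1 hd).const_sub 1
    rw [sub_zero] at h
    refine h.congr fun n => ?_
    rw [sub_eq_iff_eq_add, Finset.sum_filter_add_sum_filter_not, ← Fintype.sum_pow, hα1, one_pow]
  let K : ℝ := Fintype.card (Set R) * Fintype.card (R → R)
  have hexp : Tendsto (fun n : ℕ => Real.exp (-(d - c) * n)) atTop (𝓝 0) := by
    have hlin : Tendsto (fun n : ℕ => (d - c) * (n : ℝ)) atTop atTop :=
      tendsto_natCast_atTop_atTop.const_mul_atTop (sub_pos.2 hcd)
    refine (Real.tendsto_exp_neg_atTop_nhds_zero.comp hlin).congr fun n => ?_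
    rw [Function.comp_apply, neg_mul]
  have hlow : Tendsto (fun n : ℕ => 1 - K * Real.exp (-(d - c) * n) / W n) atTop (𝓝 1) := by
    simpa using ((hexp.const_mul K).div hW one_ne_zero).const_sub 1
  refine tendsto_of_tendsto_of_tendsto_of_le_of_le' hlow tendsto_const_nhds ?_
    (.of_forall fun n => MeasureTheory.measureReal_le_one)
  filter_upwards [hW.eventually (eventually_gt_nhds zero_lt_one)] with n hWn
  have hinj : ∀ f ∈ s n, (Finset.univ.image (copyMap f)).card = Fintype.card R := fun f hf => by
    rw [Finset.card_image_of_injective _ (hs n f hf).1, Finset.card_univ]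
  have h2 := setBernoulli_univ_real_forall_not_subset_le (s n) (retentionProb c hc0 n)
    (Real.exp_pos _) (fun f => Finset.univ.image (copyMap f)) _ hinj (fun f => ∏ i, α (f i)) hWn
  have h3 := sum_sum_inv_pow_card_inter_le (fun S => (hα S).le) hc0.le hcd.le (hs n)
  have hsub : {S : Set (Finset (Fin n)) | ∃ φ : R → S, Monotone φ ∧ Function.Injective φ}ᶜ ⊆
      {S | ∀ f ∈ s n, ¬ ((Finset.univ.image (copyMap f) : Finset _) : Set (Finset (Fin n))) ⊆ S} := by
    intro S hS f hf hfS
    have hmem : ∀ x, copyMap f x ∈ S := fun x => hfS (by simp)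
    exact hS ⟨fun x => ⟨copyMap f x, hmem x⟩, fun x y hxy => copyMap_mono f hxy,
      fun x y hxy => (hs n f hf).1 (congrArg Subtype.val hxy)⟩
  have h1 := MeasureTheory.measureReal_mono (μ := setBernoulli (Set.univ : Set (Finset (Fin n)))
    (retentionProb c hc0 n)) hsub
  rw [MeasureTheory.probReal_compl_eq_one_sub (Set.toFinite _).measurableSet] at h1
  have h4 := div_le_div_of_nonneg_right h3 (sq_nonneg (W n))
  have h5 : (W n ^ 2 + W n * (K * Real.exp (-(d - c) * n))) / W n ^ 2
      = 1 + K * Real.exp (-(d - c) * n) / W n := by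
    field_simp
  have h6 := h1.trans (h2.trans (sub_le_sub_right (h4.trans_eq h5) 1))
  linarith

end Containment

/-! ### From containment to the Ramsey property -/

section Ramsey

variable {P Q : Type*} [PartialOrder P] [PartialOrder Q]

lemma isRamsey_lex : IsRamsey (P ×ₗ Q) P Q := by
  intro χ
  by_cases h : ∃ p, ∀ q, χ (toLex (p, q)) = 1
  · obtain ⟨p, hp⟩ := h
    exact .inr ⟨fun q => toLex (p, q), fun a b hab => Prod.Lex.toLex_mono ⟨le_rfl, hab⟩,
      fun a b hab => (Prod.ext_iff.1 (toLex.injective hab)).2, hp⟩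
  · push Not at h
    choose q hq using h
    refine .inl ⟨fun p => toLex (p, q p), fun a b hab => ?_,
      fun a b hab => (Prod.ext_iff.1 (toLex.injective hab)).1,
      fun p => (Fin.eq_one_of_ne_zero _).mt (hq p) |> not_not.1⟩
    rcases hab.eq_or_lt with rfl | hlt
    · exact le_rfl
    · exact Prod.Lex.toLex_le_toLex.2 (.inl hlt)

lemma IsRamsey.of_copy {R S : Type*} [PartialOrder R] [PartialOrder S] (h : IsRamsey R P Q)
    {φ : R → S} (hmono : Monotone φ) (hinj : Function.Injective φ) : IsRamsey S P Q := by
  intro χ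
  rcases h (χ ∘ φ) with ⟨ψ, h1, h2, h3⟩ | ⟨ψ, h1, h2, h3⟩
  · exact .inl ⟨φ ∘ ψ, hmono.comp h1, hinj.comp h2, h3⟩
  · exact .inr ⟨φ ∘ ψ, hmono.comp h1, hinj.comp h2, h3⟩

lemma IsRamsey.criticalExponent_le [Nonempty P] [Nonempty Q] {R : Type*} [PartialOrder R]
    [Finite R] (h : IsRamsey R P Q) : criticalExponent R ≤ lowerRamseyExponent P Q := by
  refine le_of_forall_lt_imp_le_of_dense fun c hc => ?_
  -- The lower exponent is nonnegative even if no exponent is admissible, as the real supremum of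
  -- the empty set is `0`.
  rcases le_or_gt c 0 with hc0 | hc0
  · exact hc0.trans (Real.sSup_nonneg fun x hx => hx.1.le)
  refine le_csSup (lowerRamseyExponent_bddAbove P Q) ⟨hc0, ?_⟩
  refine tendsto_of_tendsto_of_tendsto_of_le_of_le (tendsto_containsCopy hc0 hc)
    tendsto_const_nhds (fun n => ?_) fun n => MeasureTheory.measureReal_le_one
  refine MeasureTheory.measureReal_mono ?_
  rintro S ⟨φ, hmono, hinj⟩
  exact h.of_copy hmono hinj

end Ramsey

end RandomPoset

theorem mainTheorem6 (P Q : Type*) [PartialOrder P] [PartialOrder Q] [Fintype P] [Fintype Q]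
    [Nonempty P] [Nonempty Q] :
    RandomPoset.IsRamsey (P ×ₗ Q) P Q ∧
      RandomPoset.criticalExponent (P ×ₗ Q) ≤ RandomPoset.lowerRamseyExponent P Q :=
  ⟨RandomPoset.isRamsey_lex, RandomPoset.isRamsey_lex.criticalExponent_le⟩
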